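/- Let $\mathcal X,\mathcal Y,\mathcal Z$ be finite alphabets and let $P_{Y,Z|X}$ be a discrete memoryless channel with input $X$, intended output $Y$ and interference output $Z$. For $R\in\mathbb R$, an $(n,2^{nR})$-code consists of a message set $\mathcal M=\{1,\dots,\lceil 2^{nR}\rceil\}$, an encoding function $\mathcal M\to\mathcal X^n$ and a decoding function $\mathcal Y^n\to\mathcal M\cup\{e\}$, where $e$ denotes a declared error; the message $M$ is uniformly distributed on $\mathcal M$, and $\hat M$ denotes the decoder output. For a probability mass function $G_Z$ on $\mathcal Z$, the rate $R$ is achievable with interference type $G_Z$ if there is a sequence of $(n,2^{nR})$-codes, $n\to\infty$, such that $\Pr(\hat M\neq M)\to 0$ and, for every $\epsilon>0$, $$\Pr\Big(\tfrac12\sum_{z\in\mathcal Z}\big|T_{\boldsymbol Z^n}(z)-G_Z(z)\big|\ge\epsilon\Big)\to 0,$$ where $T_{\boldsymbol Z^n}(z)=\frac1n\,|\{i : Z_i=z\}|$ is the type of the interference sequence $\boldsymbol Z^n=(Z_1,\dots,Z_n)$. The communication-interference capacity region $\mathcal C$ is the closure of the set of all pairs $(R,G_Z)$ such that $R$ is achievable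 with interference type $G_Z$. Theorem. $\mathcal C$ is the set of pairs $(R,G_Z)$, with $R\in\mathbb R$ and $G_Z$ a probability mass function on $\mathcal Z$, such that the pre-image $$\mathcal P=\Big\{P_X : \sum_{x\in\mathcal X} P_X(x)\,P_{Z|X}(z|x)=G_Z(z)\ \text{for all } z\in\mathcal Z\Big\}$$ (a set of probability mass functions $P_X$ on $\mathcal X$) is non-empty and $$R\le\max_{P_X\in\mathcal P} I(X;Y),$$ where the maximum exists and $I(X;Y)$ is the mutual information in bits of the pair $(X,Y)$ with joint distribution $P_X(x)P_{Y|X}(y|x)$. -/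

import Mathlib

open Filter Topology

namespace CommInterf

/-- Total variation distance between two functions (pmfs) on a finite alphabet. -/
noncomputable def tv {α : Type*} [Fintype α] (P Q : α → ℝ) : ℝ :=
  (1 / 2) * ∑ a, |P a - Q a|

open Classical in
/-- The type (empirical distribution) of a sequence of length `n`. -/
noncomputable def seqType {α : Type*} {n : ℕ} (s : Fin n → α) : α → ℝ :=
  fun a => (1 / (n : ℝ)) * ∑ i, (if s i = a then 1 else 0)

/-- Mutual information, in bits, between the coordinates of a pair with joint pmf `J`.
Terms with `J (x, y) = 0` vanish, which is the convention `0 log 0 = 0`. -/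
noncomputable def mutualInfo {α β : Type*} [Fintype α] [Fintype β] (J : α × β → ℝ) : ℝ :=
  ∑ x, ∑ y, J (x, y) * Real.logb 2 (J (x, y) / ((∑ y', J (x, y')) * (∑ x', J (x', y))))

section Channel

variable {X Y Z : Type*} [Fintype X] [Fintype Y] [Fintype Z]

/-- `W x (y, z)` is a conditional pmf of the two outputs `(y, z)` given the input `x`. -/
def IsChannel (W : X → Y × Z → ℝ) : Prop :=
  ∀ x, W x ∈ stdSimplex ℝ (Y × Z)

/-- The marginal channel from the input to the intended receiver. -/
noncomputable def margY (W : X → Y × Z → ℝ) (x : X) (y : Y) : ℝ := ∑ z, W x (y, z)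

/-- The marginal channel from the input to the external observer. -/
noncomputable def margZ (W : X → Y × Z → ℝ) (x : X) (z : Z) : ℝ := ∑ y, W x (y, z)

/-- `I(X;Y)` for the joint pmf `P(x) P(y|x)`. -/
noncomputable def inputInfo (W : X → Y × Z → ℝ) (P : X → ℝ) : ℝ :=
  mutualInfo fun p : X × Y => P p.1 * margY W p.1 p.2

/-- The pre-image of `G`: the input pmfs whose induced pmf of the interference is `G`. -/
def preimage (W : X → Y × Z → ℝ) (G : Z → ℝ) : Set (X → ℝ) :=
  {P | P ∈ stdSimplex ℝ X ∧ ∀ z, ∑ x, P x * margZ W x z = G z}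

/-- The number of messages of a code of length `n` and rate `R`. -/
noncomputable def numMsg (n : ℕ) (R : ℝ) : ℕ := ⌈(2 : ℝ) ^ ((n : ℝ) * R)⌉₊

/-- A code of length `n` and rate `R`. The decoder returns `none` to declare an error. -/
structure Code (X Y : Type*) (n : ℕ) (R : ℝ) where
  /-- the encoding function -/
  enc : Fin (numMsg n R) → (Fin n → X)
  /-- the decoding function -/
  dec : (Fin n → Y) → Option (Fin (numMsg n R))

/-- The pmf of the message and the two output sequences: the message is uniform and its codeword
is sent over `n` uses of the memoryless channel. -/
noncomputable def Code.law {n : ℕ} {R : ℝ} (c : Code X Y n R) (W : X → Y × Z → ℝ)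
    (ω : Fin (numMsg n R) × (Fin n → Y) × (Fin n → Z)) : ℝ :=
  (1 / (numMsg n R : ℝ)) * ∏ i, W (c.enc ω.1 i) (ω.2.1 i, ω.2.2 i)

/-- The probability of an event on the message and the two output sequences. -/
noncomputable def Code.prob {n : ℕ} {R : ℝ} (c : Code X Y n R) (W : X → Y × Z → ℝ)
    (E : Set (Fin (numMsg n R) × (Fin n → Y) × (Fin n → Z))) : ℝ :=
  ∑ ω, E.indicator (c.law W) ω

/-- The rate `R` is achievable with interference type `G`. -/
def Achievable (W : X → Y × Z → ℝ) (R : ℝ) (G : Z → ℝ) : Prop :=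
  ∃ c : (n : ℕ) → Code X Y n R,
    Tendsto (fun n => (c n).prob W {ω | (c n).dec ω.2.1 ≠ some ω.1}) atTop (𝓝 0) ∧
    ∀ ε : ℝ, 0 < ε →
      Tendsto (fun n => (c n).prob W {ω | ε ≤ tv (seqType ω.2.2) G}) atTop (𝓝 0)

/-- The communication-interference capacity region: the closure of the set of achievable pairs
of a rate and a pmf on the interference alphabet. -/
def capacityRegion (W : X → Y × Z → ℝ) : Set (ℝ × (Z → ℝ)) :=
  closure {p | p.2 ∈ stdSimplex ℝ Z ∧ Achievable W p.1 p.2}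

end Channel

end CommInterf

/-! Direct part. Let `P` map to `G` and `R < γ < I(X;Y)`. For a random codebook with i.i.d. letters
from `P`, a decoder that thresholds the likelihood ratio at `2 ^ (n γ)` errs with vanishing
probability: the information density of the true pair concentrates at `n I` (Chebyshev), and the
wrong codewords together pass with probability at most `2 ^ (n (R - γ))`. Averaged over codebooks,
the interference is i.i.d. `G`, so the expected squared distance of its type from `G` is `O(1/n)`.
The error and this distance are added into one cost, so that a single codebook makes both small
(`exists_code_error_add_cost_le`, `exists_code_le`).

Converse. Everything is expressed through the average type `Pₙ` of the codewords. The expected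
interference type is exactly the image of `Pₙ` under the channel to `Z`, and the type condition
makes it tend to `G`. For the rate, the decoder is a test between the true law of message and output
and the product of the uniform law with the i.i.d. output law of `Pₙ`. It succeeds with probability
at most `1 / M` under the product, and the divergence between the two laws is exactly `n I(Pₙ)`, so
`(1 - error) R ≤ I(Pₙ) + 1/n` (`Code.success_mul_rate_le`). A limit point of `Pₙ` in the compact
simplex lies in the pre-image of `G` and has information at least `R`, by continuity.

The same compactness shows that the region is closed; boundary rates are limits of smaller ones. -/

namespace CommInterf

/-! ### Moments under product measures. -/

section Products

variable {ι A : Type*} [Fintype ι] [DecidableEq ι] [Fintype A]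

theorem sum_prod_pi (f : ι → A → ℝ) : ∑ s : ι → A, ∏ i, f i (s i) = ∏ i, ∑ a, f i a := by
  classical
  rw [Finset.prod_univ_sum, Fintype.piFinset_univ]

theorem sum_prod_mul_mul {p : A → ℝ} (hp : ∑ a, p a = 1) (g h : A → ℝ) {i j : ι} (hij : i ≠ j) :
    ∑ s : ι → A, (∏ k, p (s k)) * (g (s i) * h (s j)) = (∑ a, p a * g a) * ∑ a, p a * h a := by
  classical
  have h1 : ∀ s : ι → A, (∏ k, p (s k)) * (g (s i) * h (s j)) =
      ∏ k, p (s k) * ((if k = i then g (s k) else 1) * (if k = j then h (s k) else 1)) := by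
    intro s
    rw [Finset.prod_mul_distrib, Finset.prod_mul_distrib, Finset.prod_ite_eq' Finset.univ i,
      Finset.prod_ite_eq' Finset.univ j]
    simp
  simp_rw [h1]
  rw [sum_prod_pi (fun k a => p a * ((if k = i then g a else 1) * (if k = j then h a else 1)))]
  have h2 : ∀ k, ∑ a, p a * ((if k = i then g a else 1) * (if k = j then h a else 1)) =
      (if k = i then ∑ a, p a * g a else 1) * (if k = j then ∑ a, p a * h a else 1) := by
    intro k
    by_cases hi : k = i
    · have hj : k ≠ j := fun hj => hij (hi.symm.trans hj)
      simp [hi, hij]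
    · by_cases hj : k = j
      · simp [hj, hij.symm]
      · simp [hi, hj, hp]
  simp_rw [h2]
  rw [Finset.prod_mul_distrib, Finset.prod_ite_eq' Finset.univ i, Finset.prod_ite_eq' Finset.univ j]
  simp

/-- The factors may differ with the index, because the output letters given a fixed codeword are
independent but not identically distributed. -/
theorem sum_prod_mul_apply {p : ι → A → ℝ} (hp : ∀ i, ∑ a, p i a = 1) (g : A → ℝ) (i : ι) :
    ∑ s : ι → A, (∏ k, p k (s k)) * g (s i) = ∑ a, p i a * g a := by
  classical
  have h1 : ∀ s : ι → A, (∏ k, p k (s k)) * g (s i) =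
      ∏ k, p k (s k) * (if k = i then g (s k) else 1) := by
    intro s
    rw [Finset.prod_mul_distrib, Finset.prod_ite_eq' Finset.univ i]
    simp
  simp_rw [h1]
  rw [sum_prod_pi (fun k a => p k a * (if k = i then g a else 1))]
  have h2 : ∀ k, ∑ a, p k a * (if k = i then g a else 1) =
      (if k = i then ∑ a, p k a * g a else 1) := by
    intro k
    by_cases hi : k = i <;> simp [hi, hp]
  simp_rw [h2]
  rw [Finset.prod_ite_eq' Finset.univ i]
  simp

theorem sum_prod_eq_one {p : ι → A → ℝ} (hp : ∀ i, ∑ a, p i a = 1) :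
    ∑ s : ι → A, ∏ i, p i (s i) = 1 := by
  rw [sum_prod_pi]
  simp [hp]

/-- The second moment of a sum of independent, identically distributed, centred variables. -/
theorem sum_prod_mul_sq {p f : A → ℝ} (hp : ∑ a, p a = 1) (hf : ∑ a, p a * f a = 0) :
    ∑ s : ι → A, (∏ k, p (s k)) * (∑ i, f (s i)) ^ 2 =
      Fintype.card ι * ∑ a, p a * f a ^ 2 := by
  classical
  have h1 : ∀ s : ι → A, (∏ k, p (s k)) * (∑ i, f (s i)) ^ 2 =
      ∑ i, ∑ j, (∏ k, p (s k)) * (f (s i) * f (s j)) := by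
    intro s
    rw [sq, Finset.sum_mul_sum, Finset.mul_sum]
    simp_rw [Finset.mul_sum]
  simp_rw [h1]
  rw [Finset.sum_comm]
  have h2 : ∀ i : ι, ∑ s : ι → A, ∑ j, (∏ k, p (s k)) * (f (s i) * f (s j)) =
      ∑ a, p a * f a ^ 2 := by
    intro i
    rw [Finset.sum_comm, Finset.sum_eq_single i]
    · simp_rw [← sq]
      exact sum_prod_mul_apply (fun _ => hp) (fun a => f a ^ 2) i
    · intro j _ hj
      rw [sum_prod_mul_mul hp f f hj.symm, hf, zero_mul]
    · simp
  simp_rw [h2]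
  simp

end Products

/-! ### One-shot random coding and the one-shot converse. -/

section OneShot

variable {A B : Type*}

open Classical in
/-- The decoder that returns the only message whose codeword passes the test `D`, if there is
exactly one such message. -/
noncomputable def uniqueDec {M : ℕ} (D : A → B → Prop) (e : Fin M → A) (y : B) :
    Option (Fin M) :=
  if h : ∃! m, D (e m) y then some h.choose else none

open Classical in
-- Union bound: an error requires that the true codeword fails the test or that some other one
-- passes it.
theorem uniqueDec_error_le {M : ℕ} (D : A → B → Prop) (e : Fin M → A) (y : B) (m : Fin M) :
    (if uniqueDec D e y ≠ some m then (1 : ℝ) else 0) ≤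
      (if D (e m) y then 0 else 1) + ∑ m' ∈ Finset.univ.erase m, if D (e m') y then 1 else 0 := by
  have hs : ∀ m' ∈ Finset.univ.erase m, (0 : ℝ) ≤ if D (e m') y then 1 else 0 := by
    intro m' _
    split_ifs <;> norm_num
  by_cases h1 : D (e m) y
  · by_cases h2 : ∃ m' ≠ m, D (e m') y
    · obtain ⟨m', hne, hm'⟩ := h2
      have := Finset.single_le_sum hs (Finset.mem_erase.2 ⟨hne, Finset.mem_univ m'⟩)
      simp only [hm', if_true] at this
      have h3 : (if uniqueDec D e y ≠ some m then (1 : ℝ) else 0) ≤ 1 := by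
        split_ifs <;> norm_num
      rw [if_pos h1]
      linarith
    · push Not at h2
      have hu : ∃! m, D (e m) y := ⟨m, h1, fun m' hm' => by
        by_contra hne
        exact h2 m' hne hm'⟩
      have hd : uniqueDec D e y = some m := by
        rw [uniqueDec, dif_pos hu]
        exact congrArg some (hu.unique hu.choose_spec.1 h1)
      rw [if_neg (not_not.2 hd), if_pos h1, zero_add]
      exact Finset.sum_nonneg hs
  · have := Finset.sum_nonneg hs
    have h3 : (if uniqueDec D e y ≠ some m then (1 : ℝ) else 0) ≤ 1 := by
      split_ifs <;> norm_num
    rw [if_neg h1]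
    linarith

variable [Fintype A] [Fintype B]

theorem exists_le_of_weighted_sum_le {p f : A → ℝ} {b : ℝ} (hp : p ∈ stdSimplex ℝ A)
    (h : ∑ a, p a * f a ≤ b) : ∃ a, f a ≤ b := by
  by_contra! hc
  have h1 : ∑ a, p a * b < ∑ a, p a * f a := by
    obtain ⟨a, ha⟩ : ∃ a, p a ≠ 0 := by
      by_contra! h0
      have := hp.2
      simp [h0] at this
    refine Finset.sum_lt_sum (fun a _ => mul_le_mul_of_nonneg_left (hc a).le (hp.1 a))
      ⟨a, Finset.mem_univ a, ?_⟩
    exact mul_lt_mul_of_pos_left (hc a) (lt_of_le_of_ne (hp.1 a) (Ne.symm ha))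
  rw [← Finset.sum_mul, hp.2, one_mul] at h1
  linarith

open Classical in
/-- Random coding with a threshold decoder, with an additional cost `g` on the codewords. -/
theorem exists_code_error_add_cost_le {M : ℕ} (hM : 0 < M) {p : A → ℝ} (hp : p ∈ stdSimplex ℝ A)
    {V : A → B → ℝ} (hV : ∀ a, V a ∈ stdSimplex ℝ B) (g : A → ℝ) {t : ℝ} (ht : 0 < t) :
    ∃ (e : Fin M → A) (d : B → Option (Fin M)),
      ∑ m, (1 / (M : ℝ)) * (∑ y, V (e m) y * (if d y ≠ some m then 1 else 0) + g (e m)) ≤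
        ∑ a, p a * ∑ y, V a y * (if V a y ≤ t * ∑ a', p a' * V a' y then 1 else 0)
          + ((M : ℝ) - 1) / t + ∑ a, p a * g a := by
  set Q : B → ℝ := fun y => ∑ a', p a' * V a' y with hQ
  obtain ⟨D, hDef⟩ : ∃ D : A → B → Prop, ∀ a y, D a y ↔ ¬ V a y ≤ t * Q y :=
    ⟨_, fun _ _ => Iff.rfl⟩
  have hM' : (0 : ℝ) < M := by exact_mod_cast hM
  have hw : (fun e : Fin M → A => ∏ k, p (e k)) ∈ stdSimplex ℝ (Fin M → A) :=
    ⟨fun e => Finset.prod_nonneg fun k _ => hp.1 _, sum_prod_eq_one fun _ => hp.2⟩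
  -- Change of measure for a wrong codeword, which is independent of `y`: where the test passes, `Q
  -- y ≤ V a y / t`, and `p a * V a y` sums to one.
  have hpair : ∑ y, Q y * ∑ a, p a * (if D a y then 1 else 0) ≤ 1 / t := by
    have h1 : ∀ y, Q y * ∑ a, p a * (if D a y then 1 else 0) ≤ (1 / t) * Q y := by
      intro y
      rw [Finset.mul_sum]
      conv_rhs => rw [hQ, Finset.mul_sum]
      refine Finset.sum_le_sum fun a _ => ?_
      have h0 : (0 : ℝ) ≤ p a * V a y := mul_nonneg (hp.1 a) ((hV a).1 y)
      by_cases hD : D a y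
      · rw [if_pos hD, mul_one, mul_comm, mul_left_comm]
        refine mul_le_mul_of_nonneg_left ?_ (hp.1 a)
        have : t * Q y ≤ V a y := (not_le.1 ((hDef a y).1 hD)).le
        rw [div_mul_eq_mul_div, one_mul, le_div_iff₀ ht, mul_comm]
        exact this
      · rw [if_neg hD, mul_zero, mul_zero]
        positivity
    refine (Finset.sum_le_sum fun y _ => h1 y).trans ?_
    rw [← Finset.mul_sum, hQ, Finset.sum_comm]
    simp_rw [← Finset.mul_sum, (hV _).2, mul_one, hp.2]
    simp
  have hm : ∀ m : Fin M, ∑ e : Fin M → A, (∏ k, p (e k)) *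
      (∑ y, V (e m) y * (if uniqueDec D e y ≠ some m then 1 else 0) + g (e m)) ≤
        ∑ a, p a * ∑ y, V a y * (if V a y ≤ t * Q y then 1 else 0)
          + ((M : ℝ) - 1) / t + ∑ a, p a * g a := by
    intro m
    have h1 : ∀ e : Fin M → A, (∏ k, p (e k)) *
        (∑ y, V (e m) y * (if uniqueDec D e y ≠ some m then 1 else 0) + g (e m)) ≤
        (∏ k, p (e k)) * (∑ y, V (e m) y * (if D (e m) y then 0 else 1))
        + (∑ m' ∈ Finset.univ.erase m, ∑ y,
          (∏ k, p (e k)) * (V (e m) y * (if D (e m') y then 1 else 0)))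
        + (∏ k, p (e k)) * g (e m) := by
      intro e
      rw [mul_add]
      refine add_le_add ?_ le_rfl
      simp_rw [← Finset.mul_sum]
      rw [← mul_add]
      refine mul_le_mul_of_nonneg_left ?_ (hw.1 e)
      rw [Finset.sum_comm, ← Finset.sum_add_distrib]
      refine Finset.sum_le_sum fun y _ => ?_
      rw [← Finset.mul_sum, ← mul_add]
      exact mul_le_mul_of_nonneg_left (uniqueDec_error_le D e y m) ((hV _).1 y)
    refine (Finset.sum_le_sum fun e _ => h1 e).trans ?_
    rw [Finset.sum_add_distrib, Finset.sum_add_distrib, sum_prod_mul_apply (p := fun _ => p) (fun _ => hp.2) g m,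
      sum_prod_mul_apply (p := fun _ => p) (fun _ => hp.2) (fun a => ∑ y, V a y * (if D a y then 0 else 1)) m]
    refine add_le_add (add_le_add (le_of_eq ?_) ?_) le_rfl
    · refine Finset.sum_congr rfl fun a _ => ?_
      congr 1
      refine Finset.sum_congr rfl fun y _ => ?_
      simp only [hDef, ite_not]
    · rw [Finset.sum_comm]
      have h2 : ∀ m' ∈ Finset.univ.erase m, ∑ e : Fin M → A, ∑ y,
          (∏ k, p (e k)) * (V (e m) y * (if D (e m') y then 1 else 0)) ≤ 1 / t := by
        intro m' hm'
        rw [Finset.sum_comm]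
        refine le_trans (le_of_eq ?_) hpair
        refine Finset.sum_congr rfl fun y _ => ?_
        exact sum_prod_mul_mul hp.2 (fun a => V a y) (fun a => if D a y then 1 else 0)
          (Finset.ne_of_mem_erase hm').symm
      refine (Finset.sum_le_card_nsmul _ _ _ h2).trans (le_of_eq ?_)
      rw [Finset.card_erase_of_mem (Finset.mem_univ m), Finset.card_univ, Fintype.card_fin,
        nsmul_eq_mul, Nat.cast_pred hM]
      ring
  obtain ⟨e, he⟩ := exists_le_of_weighted_sum_le (b := ∑ a, p a * ∑ y, V a y *
      (if V a y ≤ t * Q y then 1 else 0) + ((M : ℝ) - 1) / t + ∑ a, p a * g a) hw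
    (f := fun e => ∑ m, (1 / (M : ℝ)) *
      (∑ y, V (e m) y * (if uniqueDec D e y ≠ some m then 1 else 0) + g (e m))) (by
      simp_rw [← Finset.mul_sum Finset.univ, mul_left_comm _ (1 / (M : ℝ))]
      simp_rw [Finset.mul_sum (Finset.univ : Finset (Fin M)) _ (∏ k, p _)]
      rw [← Finset.mul_sum, Finset.sum_comm]
      rw [one_div, inv_mul_le_iff₀ hM']
      refine (Finset.sum_le_card_nsmul _ _ _ fun m _ => hm m).trans (le_of_eq ?_)
      rw [Finset.card_univ, Fintype.card_fin, nsmul_eq_mul])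
  exact ⟨e, uniqueDec D e, he⟩

/-- If the event `E` has probability at most `1 / M` under `K`, its probability under `J` times
`log M` is at most one bit more than the divergence of `J` from `K`. -/
theorem prob_mul_logb_le_divergence {J K : A → ℝ} (hJ : J ∈ stdSimplex ℝ A) (hK : ∀ a, 0 ≤ K a)
    (hK1 : ∑ a, K a ≤ 1) (hJK : ∀ a, J a ≠ 0 → K a ≠ 0) {M : ℝ} (hM : 1 ≤ M) (E : A → Prop) [DecidablePred E]
    (hE : M * ∑ a, (if E a then K a else 0) ≤ 1) :
    (∑ a, if E a then J a else 0) * Real.logb 2 M ≤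
      ∑ a, J a * Real.logb 2 (J a / K a) + 1 := by
  have hM0 : 0 < M := by linarith
  have hl2 : 0 < Real.log 2 := Real.log_pos (by norm_num)
  -- `f` tilts `K` by `M` on `E`. The tilted mass is at most 2, one from all of `K` and one from
  -- `hE`; halving it costs the extra bit.
  let f : A → ℝ := fun a => if E a then M else 1
  have hf : ∀ a, 0 < f a := by
    intro a
    simp only [f]
    split_ifs <;> linarith
  have hpt : ∀ a, J a * Real.log (f a) - J a * Real.log (J a / K a) - J a * Real.log 2 ≤
      K a * f a / 2 - J a := by
    intro a
    by_cases ha : J a = 0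
    · rw [ha]
      have := mul_nonneg (hK a) (hf a).le
      simp only [zero_mul, sub_zero]
      positivity
    · have hJp : 0 < J a := lt_of_le_of_ne (hJ.1 a) (Ne.symm ha)
      have hKp : 0 < K a := lt_of_le_of_ne (hK a) (Ne.symm (hJK a ha))
      have h1 := Real.log_le_sub_one_of_pos (x := K a * f a / (2 * J a))
        (div_pos (mul_pos hKp (hf a)) (by positivity))
      rw [Real.log_div (mul_pos hKp (hf a)).ne' (by positivity),
        Real.log_mul hKp.ne' (hf a).ne', Real.log_mul (by norm_num) ha] at h1
      rw [Real.log_div ha hKp.ne']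
      have h2 := mul_le_mul_of_nonneg_left h1 hJp.le
      have h3 : J a * (K a * f a / (2 * J a) - 1) = K a * f a / 2 - J a := by
        field_simp
      rw [h3] at h2
      linarith
  have hsum := Finset.sum_le_sum fun a (_ : a ∈ Finset.univ) => hpt a
  rw [Finset.sum_sub_distrib, Finset.sum_sub_distrib, Finset.sum_sub_distrib, ← Finset.sum_mul,
    hJ.2, ← Finset.sum_div] at hsum
  have hKf : ∑ a, K a * f a ≤ 2 := by
    have : ∀ a, K a * f a ≤ K a + M * (if E a then K a else 0) := by
      intro a
      simp only [f]
      split_ifs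
      · nlinarith [hK a]
      · simp
    refine (Finset.sum_le_sum fun a _ => this a).trans ?_
    rw [Finset.sum_add_distrib, ← Finset.mul_sum]
    linarith
  have hJf : ∑ a, J a * Real.log (f a) = (∑ a, if E a then J a else 0) * Real.log M := by
    rw [Finset.sum_mul]
    refine Finset.sum_congr rfl fun a _ => ?_
    simp only [f]
    split_ifs <;> simp
  rw [hJf] at hsum
  have hfin : (∑ a, if E a then J a else 0) * Real.log M ≤
      ∑ a, J a * Real.log (J a / K a) + Real.log 2 := by linarith
  simp only [Real.logb]
  simp_rw [← mul_div_assoc]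
  rw [← Finset.sum_div, div_add_one hl2.ne']
  exact div_le_div_of_nonneg_right hfin hl2.le

end OneShot

/-! ### Mutual information: continuity and compactness. -/

section Information

variable {X Y Z : Type*}

theorem margY_mem_stdSimplex [Fintype Y] [Fintype Z] {W : X → Y × Z → ℝ} (hW : IsChannel W) (x : X) :
    margY W x ∈ stdSimplex ℝ Y := by
  refine ⟨fun y => Finset.sum_nonneg fun z _ => (hW x).1 _, ?_⟩
  rw [← (hW x).2, Fintype.sum_prod_type]
  rfl

theorem margZ_mem_stdSimplex [Fintype Y] [Fintype Z] {W : X → Y × Z → ℝ} (hW : IsChannel W) (x : X) :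
    margZ W x ∈ stdSimplex ℝ Z := by
  refine ⟨fun y => Finset.sum_nonneg fun z _ => (hW x).1 _, ?_⟩
  rw [← (hW x).2, Fintype.sum_prod_type_right]
  rfl

variable [Fintype X]

/-- The pmf of the output of the channel `V` with input pmf `P`. -/
def outPMF (V : X → Y → ℝ) (P : X → ℝ) (y : Y) : ℝ := ∑ x, P x * V x y

theorem continuous_outPMF (V : X → Y → ℝ) (y : Y) : Continuous fun P => outPMF V P y := by
  unfold outPMF
  fun_prop

variable [Fintype Y]

theorem mem_preimage_iff {W : X → Y × Z → ℝ} {G : Z → ℝ} {P : X → ℝ} :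
    P ∈ preimage W G ↔ P ∈ stdSimplex ℝ X ∧ outPMF (margZ W) P = G :=
  and_congr_right fun _ => funext_iff.symm

variable [Fintype Z]

theorem outPMF_mem_stdSimplex {V : X → Y → ℝ} (hV : ∀ x, V x ∈ stdSimplex ℝ Y) {P : X → ℝ}
    (hP : P ∈ stdSimplex ℝ X) : outPMF V P ∈ stdSimplex ℝ Y := by
  refine ⟨fun y => Finset.sum_nonneg fun x _ => mul_nonneg (hP.1 x) ((hV x).1 y), ?_⟩
  simp only [outPMF]
  rw [Finset.sum_comm]
  simp_rw [← Finset.mul_sum, (hV _).2, mul_one]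
  exact hP.2

theorem outPMF_pos {V : X → Y → ℝ} (hV : ∀ x, V x ∈ stdSimplex ℝ Y) {P : X → ℝ}
    (hP : P ∈ stdSimplex ℝ X) {x : X} {y : Y} (hx : P x ≠ 0) (hxy : V x y ≠ 0) :
    0 < outPMF V P y := by
  have h1 : 0 < P x * V x y := mul_pos (lt_of_le_of_ne (hP.1 x) hx.symm)
    (lt_of_le_of_ne ((hV x).1 y) hxy.symm)
  exact h1.trans_le (Finset.single_le_sum (f := fun x => P x * V x y)
    (fun x _ => mul_nonneg (hP.1 x) ((hV x).1 y)) (Finset.mem_univ x))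

/-- The information density of the channel `V` with input pmf `P`. -/
noncomputable def infoDensity (V : X → Y → ℝ) (P : X → ℝ) (x : X) (y : Y) : ℝ :=
  Real.logb 2 (V x y / outPMF V P y)

theorem inputInfo_eq_sum_infoDensity {W : X → Y × Z → ℝ} (hW : IsChannel W) (P : X → ℝ) :
    inputInfo W P = ∑ x, P x * ∑ y, margY W x y * infoDensity (margY W) P x y := by
  simp only [inputInfo, mutualInfo]
  refine Finset.sum_congr rfl fun x _ => ?_
  rw [Finset.mul_sum]
  refine Finset.sum_congr rfl fun y _ => ?_
  by_cases hx : P x = 0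
  · simp [hx]
  · have h1 : ∑ y', P x * margY W x y' = P x := by
      rw [← Finset.mul_sum, (margY_mem_stdSimplex hW x).2, mul_one]
    rw [h1, mul_div_mul_left _ _ hx, mul_assoc]
    rfl

/-- This is `H(Y) - H(Y|X)`. The conditional term is linear in `P` and `t log t` is continuous at
zero, so continuity holds up to the boundary of the simplex, which the ratio form does not show. -/
theorem inputInfo_eq_sub {W : X → Y × Z → ℝ} (hW : IsChannel W) {P : X → ℝ}
    (hP : P ∈ stdSimplex ℝ X) :
    inputInfo W P = ∑ x, P x * ∑ y, margY W x y * Real.logb 2 (margY W x y) -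
      ∑ y, outPMF (margY W) P y * Real.logb 2 (outPMF (margY W) P y) := by
  have h1 : ∑ y, outPMF (margY W) P y * Real.logb 2 (outPMF (margY W) P y) =
      ∑ x, ∑ y, P x * (margY W x y * Real.logb 2 (outPMF (margY W) P y)) := by
    rw [Finset.sum_comm]
    refine Finset.sum_congr rfl fun y _ => ?_
    conv_lhs => rw [outPMF, Finset.sum_mul]
    refine Finset.sum_congr rfl fun x _ => ?_
    rw [mul_assoc]
    rfl
  rw [inputInfo_eq_sum_infoDensity hW, h1]
  simp_rw [Finset.mul_sum]
  simp_rw [← Finset.sum_sub_distrib]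
  refine Finset.sum_congr rfl fun x _ => Finset.sum_congr rfl fun y _ => ?_
  by_cases hx : P x = 0
  · simp [hx]
  by_cases hy : margY W x y = 0
  · simp [hy]
  rw [infoDensity,
    Real.logb_div hy (outPMF_pos (margY_mem_stdSimplex hW) hP hx hy).ne']
  ring

theorem continuousOn_inputInfo {W : X → Y × Z → ℝ} (hW : IsChannel W) :
    ContinuousOn (inputInfo W) (stdSimplex ℝ X) := by
  refine ContinuousOn.congr (Continuous.continuousOn ?_) fun P hP => inputInfo_eq_sub hW hP
  refine Continuous.sub (by fun_prop) (continuous_finsetSum _ fun y _ => ?_)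
  simp only [Real.logb]
  simp_rw [← mul_div_assoc]
  exact (Real.continuous_mul_log.comp (continuous_outPMF _ y)).div_const _

/-- The pre-image is compact and the information continuous on it, so non-emptiness is enough for
the maximum to exist. -/
theorem exists_isGreatest_iff {W : X → Y × Z → ℝ} (hW : IsChannel W) (G : Z → ℝ) (R : ℝ) :
    (∃ C, IsGreatest (inputInfo W '' preimage W G) C ∧ R ≤ C) ↔
      ∃ P ∈ preimage W G, R ≤ inputInfo W P := by
  constructor
  · rintro ⟨C, ⟨⟨P, hP, rfl⟩, -⟩, hR⟩
    exact ⟨P, hP, hR⟩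
  · rintro ⟨P, hP, hR⟩
    have hset : preimage W G = stdSimplex ℝ X ∩ {P | outPMF (margZ W) P = G} := by
      ext P
      exact mem_preimage_iff
    have hc : IsCompact (preimage W G) := by
      rw [hset]
      refine (isCompact_stdSimplex ℝ X).inter_right (isClosed_eq ?_ continuous_const)
      exact continuous_pi fun z => continuous_outPMF _ z
    obtain ⟨C, hC⟩ := (hc.image_of_continuousOn ((continuousOn_inputInfo hW).mono fun P hP =>
      hP.1)).exists_isGreatest ⟨_, P, hP, rfl⟩
    exact ⟨C, hC, hR.trans (hC.2 ⟨P, hP, rfl⟩)⟩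

theorem isClosed_region {W : X → Y × Z → ℝ} (hW : IsChannel W) :
    IsClosed {p : ℝ × (Z → ℝ) | ∃ P ∈ preimage W p.2, p.1 ≤ inputInfo W P} := by
  rw [← isSeqClosed_iff_isClosed]
  intro u p hu hp
  choose P hP hR using hu
  obtain ⟨P₀, hP₀, φ, hφ, hlim⟩ := (isCompact_stdSimplex ℝ X).tendsto_subseq fun n => (hP n).1
  have hp' := hp.comp hφ.tendsto_atTop
  refine ⟨P₀, mem_preimage_iff.2 ⟨hP₀, ?_⟩, ?_⟩
  · refine tendsto_nhds_unique ?_ ((continuous_snd.tendsto p).comp hp')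
    have h1 := (continuous_pi fun z => continuous_outPMF (margZ W) z).tendsto P₀ |>.comp hlim
    refine h1.congr fun n => ?_
    exact (mem_preimage_iff.1 (hP (φ n))).2
  · refine le_of_tendsto_of_tendsto ((continuous_fst.tendsto p).comp hp') ?_
      (Eventually.of_forall fun n => hR (φ n))
    have h1 := (continuousOn_inputInfo hW P₀ hP₀).tendsto
    exact h1.comp (tendsto_nhdsWithin_iff.2 ⟨hlim, Eventually.of_forall fun n => (hP (φ n)).1⟩)

end Information

/-! ### Concentration for memoryless blocks. -/

section Memoryless

variable {X Y Z : Type*}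

/-- The law of the output block given the input block over uses of a memoryless channel. -/
def blockChannel (V : X → Y → ℝ) {n : ℕ} (x : Fin n → X) (y : Fin n → Y) : ℝ :=
  ∏ i, V (x i) (y i)

theorem blockChannel_mem_stdSimplex [Fintype Y] {V : X → Y → ℝ} (hV : ∀ x, V x ∈ stdSimplex ℝ Y)
    {n : ℕ} (x : Fin n → X) : blockChannel V x ∈ stdSimplex ℝ (Fin n → Y) :=
  ⟨fun y => Finset.prod_nonneg fun i _ => (hV (x i)).1 (y i),
    sum_prod_eq_one fun i => (hV (x i)).2⟩

theorem sum_prod_mul_blockChannel [Fintype X] (V : X → Y → ℝ) (P : X → ℝ) {n : ℕ}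
    (y : Fin n → Y) :
    ∑ x : Fin n → X, (∏ i, P (x i)) * blockChannel V x y = ∏ i, outPMF V P (y i) := by
  simp only [blockChannel, outPMF, ← Finset.prod_mul_distrib]
  exact sum_prod_pi fun i a => P a * V a (y i)

theorem logb_blockChannel_div [Fintype X] {V : X → Y → ℝ} {P : X → ℝ} {n : ℕ}
    {x : Fin n → X} {y : Fin n → Y} (hxy : ∀ i, V (x i) (y i) ≠ 0)
    (hy : ∀ i, outPMF V P (y i) ≠ 0) :
    Real.logb 2 (blockChannel V x y / ∏ i, outPMF V P (y i)) =
      ∑ i, infoDensity V P (x i) (y i) := by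
  rw [blockChannel, ← Finset.prod_div_distrib, Real.logb_prod]
  · rfl
  · exact fun i _ => div_ne_zero (hxy i) (hy i)

variable [Fintype X] [Fintype Y]

/-- Chebyshev's inequality: failing the test means that the sum of `n` i.i.d. information densities
is at most `n γ`, which is `n (I - γ)` below its mean. -/
theorem sum_threshold_error_le {V : X → Y → ℝ} (hV : ∀ x, V x ∈ stdSimplex ℝ Y) {P : X → ℝ}
    (hP : P ∈ stdSimplex ℝ X) {I γ : ℝ}
    (hI : I = ∑ x, P x * ∑ y, V x y * infoDensity V P x y) (hγ : γ < I) {n : ℕ} (hn : 0 < n) :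
    ∑ x : Fin n → X, (∏ i, P (x i)) * ∑ y, blockChannel V x y *
        (if blockChannel V x y ≤ 2 ^ ((n : ℝ) * γ) * ∏ i, outPMF V P (y i) then 1 else 0) ≤
      (∑ a : X × Y, P a.1 * V a.1 a.2 * (infoDensity V P a.1 a.2 - I) ^ 2) / (I - γ) ^ 2
        * (1 / (n : ℝ)) := by
  have hn' : (0 : ℝ) < n := by exact_mod_cast hn
  have hIγ : 0 < I - γ := by linarith
  let q : X × Y → ℝ := fun a => P a.1 * V a.1 a.2
  have hq0 : ∀ a, 0 ≤ q a := fun a => mul_nonneg (hP.1 _) ((hV _).1 _)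
  have hq1 : ∑ a, q a = 1 := by
    simp only [q, Fintype.sum_prod_type]
    simp_rw [← Finset.mul_sum, (hV _).2, mul_one]
    exact hP.2
  have hf : ∑ a, q a * (infoDensity V P a.1 a.2 - I) = 0 := by
    simp_rw [mul_sub]
    rw [Finset.sum_sub_distrib, ← Finset.sum_mul, hq1, one_mul, sub_eq_zero, hI]
    simp only [q, Fintype.sum_prod_type, Finset.mul_sum, mul_assoc]
  have hvar := sum_prod_mul_sq (ι := Fin n) hq1 hf
  rw [Fintype.card_fin] at hvar
  simp_rw [Finset.mul_sum]
  rw [← Fintype.sum_prod_type' (f := fun (x : Fin n → X) (y : Fin n → Y) =>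
    (∏ i, P (x i)) * (blockChannel V x y *
      (if blockChannel V x y ≤ 2 ^ ((n : ℝ) * γ) * ∏ i, outPMF V P (y i) then 1 else 0))),
    ← (Equiv.arrowProdEquivProdArrow (Fin n) (fun _ => X) (fun _ => Y)).sum_comp]
  have hpt : ∀ s : Fin n → X × Y,
      (∏ i, P (s i).1) * (blockChannel V (fun i => (s i).1) (fun i => (s i).2) *
        (if blockChannel V (fun i => (s i).1) (fun i => (s i).2) ≤
          2 ^ ((n : ℝ) * γ) * ∏ i, outPMF V P (s i).2 then 1 else 0)) ≤
      (1 / (n * (I - γ)) ^ 2) *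
        ((∏ i, q (s i)) * (∑ i, (infoDensity V P (s i).1 (s i).2 - I)) ^ 2) := by
    intro s
    have hprod : (∏ i, P (s i).1) * blockChannel V (fun i => (s i).1) (fun i => (s i).2) =
        ∏ i, q (s i) := by
      rw [blockChannel, ← Finset.prod_mul_distrib]
    rw [← mul_assoc, hprod]
    have hqs : 0 ≤ ∏ i, q (s i) := Finset.prod_nonneg fun i _ => hq0 _
    split_ifs with h
    -- Blocks of zero mass contribute nothing; on the others every factor is positive and logarithms
    -- may be taken.
    · by_cases hz : ∏ i, q (s i) = 0
      · simp [hz]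
      have hqi : ∀ i, q (s i) ≠ 0 := fun i => Finset.prod_ne_zero_iff.1 hz i (Finset.mem_univ i)
      have hVi : ∀ i, V (s i).1 (s i).2 ≠ 0 := fun i => right_ne_zero_of_mul (hqi i)
      have hQi : ∀ i, 0 < outPMF V P (s i).2 := fun i =>
        outPMF_pos hV hP (left_ne_zero_of_mul (hqi i)) (hVi i)
      have hQ : 0 < ∏ i, outPMF V P (s i).2 := Finset.prod_pos fun i _ => hQi i
      have hB : 0 < blockChannel V (fun i => (s i).1) (fun i => (s i).2) :=
        Finset.prod_pos fun i _ => lt_of_le_of_ne ((hV _).1 _) (hVi i).symm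
      have hlog : ∑ i, infoDensity V P (s i).1 (s i).2 ≤ n * γ := by
        rw [← logb_blockChannel_div (x := fun i => (s i).1) (y := fun i => (s i).2) hVi
          fun i => (hQi i).ne', Real.logb_le_iff_le_rpow (by norm_num) (div_pos hB hQ),
          div_le_iff₀ hQ]
        exact h
      have hsum : n * (I - γ) ≤ -∑ i, (infoDensity V P (s i).1 (s i).2 - I) := by
        rw [Finset.sum_sub_distrib, Finset.sum_const, Finset.card_univ, Fintype.card_fin,
          nsmul_eq_mul]
        linarith
      have hsq : (n * (I - γ)) ^ 2 ≤ (∑ i, (infoDensity V P (s i).1 (s i).2 - I)) ^ 2 := by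
        rw [← neg_sq (∑ i, _)]
        exact pow_le_pow_left₀ (by positivity) hsum 2
      rw [mul_one, one_div, ← div_eq_inv_mul, le_div_iff₀ (by positivity)]
      exact mul_le_mul_of_nonneg_left hsq hqs
    · rw [mul_zero]
      positivity
  refine (Finset.sum_le_sum fun s _ => hpt s).trans (le_of_eq ?_)
  rw [← Finset.mul_sum, hvar]
  simp only [q]
  field_simp

/-- The squared Euclidean distance of the type of `s` from `G`. -/
noncomputable def typeSqDist [Fintype Z] (G : Z → ℝ) {n : ℕ} (s : Fin n → Z) : ℝ :=
  ∑ z, (seqType s z - G z) ^ 2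

theorem typeSqDist_nonneg [Fintype Z] (G : Z → ℝ) {n : ℕ} (s : Fin n → Z) :
    0 ≤ typeSqDist G s :=
  Finset.sum_nonneg fun _ _ => sq_nonneg _

/-- Cauchy–Schwarz. The squared distance serves as the coding cost because its mean is a sum of
variances. -/
theorem tv_sq_le [Fintype Z] (G : Z → ℝ) {n : ℕ} (s : Fin n → Z) :
    tv (seqType s) G ^ 2 ≤ Fintype.card Z * typeSqDist G s := by
  have h1 : (∑ z, |seqType s z - G z|) ^ 2 ≤ Fintype.card Z * typeSqDist G s := by
    refine (sq_sum_le_card_mul_sum_sq).trans (le_of_eq ?_)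
    simp [typeSqDist]
  have h2 := sq_nonneg (∑ z, |seqType s z - G z|)
  rw [tv, mul_pow]
  linarith

theorem sum_prod_mul_typeSqDist_le [Fintype Z] {G : Z → ℝ} (hG : G ∈ stdSimplex ℝ Z) {n : ℕ}
    (hn : 0 < n) :
    ∑ s : Fin n → Z, (∏ i, G (s i)) * typeSqDist G s ≤ Fintype.card Z * (1 / (n : ℝ)) := by
  classical
  have hn' : (0 : ℝ) < n := by exact_mod_cast hn
  simp only [typeSqDist, Finset.mul_sum]
  rw [Finset.sum_comm]
  have h1 : ∀ z, ∑ s : Fin n → Z, (∏ i, G (s i)) * (seqType s z - G z) ^ 2 ≤ 1 / (n : ℝ) := by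
    intro z
    have hf : ∑ a, G a * ((if a = z then 1 else 0) - G z) = 0 := by
      simp_rw [mul_sub]
      rw [Finset.sum_sub_distrib, ← Finset.sum_mul, hG.2]
      simp
    have hvar := sum_prod_mul_sq (ι := Fin n) hG.2 hf
    have h2 : ∀ s : Fin n → Z, seqType s z - G z =
        (1 / (n : ℝ)) * ∑ i, ((if s i = z then 1 else 0) - G z) := by
      intro s
      rw [Finset.sum_sub_distrib, mul_sub]
      simp only [seqType, Finset.sum_const, Finset.card_univ, Fintype.card_fin, nsmul_eq_mul]
      field_simp
    have h3 : ∑ a, G a * ((if a = z then 1 else 0) - G z) ^ 2 ≤ 1 := by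
      refine le_trans (Finset.sum_le_sum fun a _ => ?_) hG.2.le
      refine mul_le_of_le_one_right (hG.1 a) ?_
      have hz0 := hG.1 z
      have hz1 : G z ≤ 1 := by
        rw [← hG.2]
        exact Finset.single_le_sum (fun z _ => hG.1 z) (Finset.mem_univ z)
      split_ifs <;> nlinarith
    simp_rw [h2, mul_pow, mul_left_comm _ ((1 / (n : ℝ)) ^ 2)]
    rw [← Finset.mul_sum, hvar, Fintype.card_fin]
    have h4 : (1 / (n : ℝ)) ^ 2 * (n * ∑ a, G a * ((if a = z then 1 else 0) - G z) ^ 2) =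
        (1 / (n : ℝ)) * ∑ a, G a * ((if a = z then 1 else 0) - G z) ^ 2 := by
      field_simp
    rw [h4]
    exact mul_le_of_le_one_right (by positivity) h3
  refine (Finset.sum_le_card_nsmul _ _ _ fun z _ => h1 z).trans (le_of_eq ?_)
  rw [Finset.card_univ, nsmul_eq_mul]

end Memoryless

/-! ### Marginals and probabilities of a code. -/

section CodeProb

variable {X Y Z : Type*} [Fintype Y] [Fintype Z]

theorem numMsg_pos (n : ℕ) (R : ℝ) : 0 < numMsg n R :=
  Nat.ceil_pos.2 (by positivity)

theorem numMsg_sub_one_le (n : ℕ) (R : ℝ) : (numMsg n R : ℝ) - 1 ≤ 2 ^ ((n : ℝ) * R) := by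
  have := Nat.ceil_lt_add_one (a := (2 : ℝ) ^ ((n : ℝ) * R)) (by positivity)
  rw [numMsg]
  linarith

theorem Code.law_nonneg {W : X → Y × Z → ℝ} (hW : IsChannel W) {n : ℕ} {R : ℝ}
    (c : Code X Y n R) (ω : Fin (numMsg n R) × (Fin n → Y) × (Fin n → Z)) : 0 ≤ c.law W ω :=
  mul_nonneg (by positivity) (Finset.prod_nonneg fun _ _ => (hW _).1 _)

theorem Code.sum_law_mul_fst {n : ℕ} {R : ℝ} (c : Code X Y n R) (W : X → Y × Z → ℝ)
    (F : Fin (numMsg n R) → (Fin n → Y) → ℝ) :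
    ∑ ω, c.law W ω * F ω.1 ω.2.1 = ∑ m, (1 / (numMsg n R : ℝ)) *
      ∑ y, blockChannel (margY W) (c.enc m) y * F m y := by
  rw [Fintype.sum_prod_type]
  refine Finset.sum_congr rfl fun m _ => ?_
  rw [Fintype.sum_prod_type, Finset.mul_sum]
  refine Finset.sum_congr rfl fun y _ => ?_
  simp only [Code.law, blockChannel, margY]
  rw [← Finset.sum_mul, ← Finset.mul_sum, sum_prod_pi fun i z => W (c.enc m i) (y i, z), mul_assoc]

theorem Code.sum_law_mul_snd {n : ℕ} {R : ℝ} (c : Code X Y n R) (W : X → Y × Z → ℝ)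
    (F : (Fin n → Z) → ℝ) :
    ∑ ω, c.law W ω * F ω.2.2 = ∑ m, (1 / (numMsg n R : ℝ)) *
      ∑ z, blockChannel (margZ W) (c.enc m) z * F z := by
  rw [Fintype.sum_prod_type]
  refine Finset.sum_congr rfl fun m _ => ?_
  rw [Fintype.sum_prod_type_right, Finset.mul_sum]
  refine Finset.sum_congr rfl fun z _ => ?_
  simp only [Code.law, blockChannel, margZ]
  rw [← Finset.sum_mul, ← Finset.mul_sum, sum_prod_pi fun i y => W (c.enc m i) (y, z i), mul_assoc]

theorem Code.prob_setOf {n : ℕ} {R : ℝ} (c : Code X Y n R) (W : X → Y × Z → ℝ)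
    (q : Fin (numMsg n R) × (Fin n → Y) × (Fin n → Z) → Prop) [DecidablePred q] :
    c.prob W {ω | q ω} = ∑ ω, c.law W ω * (if q ω then 1 else 0) := by
  simp only [Code.prob, Set.indicator_apply, Set.mem_ofPred_eq, mul_ite, mul_one, mul_zero]

theorem Code.prob_nonneg {W : X → Y × Z → ℝ} (hW : IsChannel W) {n : ℕ} {R : ℝ}
    (c : Code X Y n R) (E : Set (Fin (numMsg n R) × (Fin n → Y) × (Fin n → Z))) :
    0 ≤ c.prob W E :=
  Finset.sum_nonneg fun ω _ => Set.indicator_nonneg (fun ω _ => c.law_nonneg hW ω) ω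

theorem Code.sum_law {W : X → Y × Z → ℝ} (hW : IsChannel W) {n : ℕ} {R : ℝ}
    (c : Code X Y n R) : ∑ ω, c.law W ω = 1 := by
  have h := c.sum_law_mul_fst W fun _ _ => 1
  simp only [mul_one, (blockChannel_mem_stdSimplex (margY_mem_stdSimplex hW) _).2] at h
  rw [h, Finset.sum_const, Finset.card_univ, Fintype.card_fin, nsmul_eq_mul]
  exact mul_one_div_cancel (by exact_mod_cast (numMsg_pos n R).ne')

/-- Markov's inequality for the squared distance. -/
theorem Code.prob_tv_le {W : X → Y × Z → ℝ} (hW : IsChannel W) {n : ℕ} {R : ℝ}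
    (c : Code X Y n R) (G : Z → ℝ) {ε : ℝ} (hε : 0 < ε) :
    c.prob W {ω | ε ≤ tv (seqType ω.2.2) G} ≤
      Fintype.card Z / ε ^ 2 * ∑ ω, c.law W ω * typeSqDist G ω.2.2 := by
  classical
  rw [c.prob_setOf, Finset.mul_sum]
  refine Finset.sum_le_sum fun ω _ => ?_
  rw [mul_left_comm]
  refine mul_le_mul_of_nonneg_left ?_ (c.law_nonneg hW ω)
  split_ifs with h
  · rw [div_mul_eq_mul_div, le_div_iff₀ (by positivity), one_mul]
    exact (pow_le_pow_left₀ hε.le h 2).trans (tv_sq_le G _)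
  · have := typeSqDist_nonneg G ω.2.2
    positivity

end CodeProb

/-! ### Direct part. -/

section Achievability

variable {X Y Z : Type*} [Fintype X] [Fintype Y] [Fintype Z]

open Classical in
theorem exists_code_le {W : X → Y × Z → ℝ} (hW : IsChannel W) {P : X → ℝ}
    (hP : P ∈ stdSimplex ℝ X) {γ : ℝ} (hγ : γ < inputInfo W P) (R : ℝ) {n : ℕ} (hn : 0 < n) :
    ∃ c : Code X Y n R, c.prob W {ω | c.dec ω.2.1 ≠ some ω.1} +
        ∑ ω, c.law W ω * typeSqDist (outPMF (margZ W) P) ω.2.2 ≤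
      (∑ a : X × Y, P a.1 * margY W a.1 a.2 *
        (infoDensity (margY W) P a.1 a.2 - inputInfo W P) ^ 2) / (inputInfo W P - γ) ^ 2
          * (1 / (n : ℝ)) + 2 ^ ((n : ℝ) * (R - γ)) + Fintype.card Z * (1 / (n : ℝ)) := by
  have hp : (fun x : Fin n → X => ∏ i, P (x i)) ∈ stdSimplex ℝ (Fin n → X) :=
    ⟨fun x => Finset.prod_nonneg fun _ _ => hP.1 _, sum_prod_eq_one fun _ => hP.2⟩
  obtain ⟨e, d, h⟩ := exists_code_error_add_cost_le (numMsg_pos n R) hp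
    (V := blockChannel (margY W)) (fun x => blockChannel_mem_stdSimplex (margY_mem_stdSimplex hW) x)
    (fun x => ∑ z, blockChannel (margZ W) x z * typeSqDist (outPMF (margZ W) P) z)
    (t := 2 ^ ((n : ℝ) * γ)) (by positivity)
  let c : Code X Y n R := ⟨e, d⟩
  refine ⟨c, ?_⟩
  rw [c.prob_setOf, c.sum_law_mul_snd]
  have h1 := c.sum_law_mul_fst W fun m y => if d y ≠ some m then 1 else 0
  refine (le_of_eq ?_).trans (h.trans (add_le_add (add_le_add ?_ ?_) ?_))
  · simp_rw [mul_add]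
    rw [Finset.sum_add_distrib]
    refine congrArg₂ _ ?_ rfl
    exact h1
  · simp_rw [sum_prod_mul_blockChannel]
    exact sum_threshold_error_le (margY_mem_stdSimplex hW) hP (inputInfo_eq_sum_infoDensity hW P)
      hγ hn
  -- Only `M - 1` codewords compete with the true one, so the ceiling in the number of messages
  -- costs nothing.
  · rw [div_le_iff₀ (by positivity), ← Real.rpow_add (by norm_num)]
    refine (numMsg_sub_one_le n R).trans (le_of_eq ?_)
    congr 1
    ring
  · refine (le_of_eq ?_).trans
      (sum_prod_mul_typeSqDist_le (outPMF_mem_stdSimplex (margZ_mem_stdSimplex hW) hP) hn)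
    simp_rw [Finset.mul_sum]
    rw [Finset.sum_comm]
    simp_rw [← mul_assoc, ← Finset.sum_mul, sum_prod_mul_blockChannel]

theorem achievable_of_lt_inputInfo {W : X → Y × Z → ℝ} (hW : IsChannel W) {P : X → ℝ}
    (hP : P ∈ stdSimplex ℝ X) {R : ℝ} (hR : R < inputInfo W P) :
    Achievable W R (outPMF (margZ W) P) := by
  obtain ⟨γ, hRγ, hγ⟩ := exists_between hR
  obtain ⟨x₀⟩ : Nonempty X := by
    by_contra h
    rw [not_nonempty_iff] at h
    simpa using hP.2
  -- The bound needs `n > 0`; at `n = 0` any code serves.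
  have hex : ∀ n : ℕ, ∃ c : Code X Y n R, 0 < n → _ := fun n => by
    rcases Nat.eq_zero_or_pos n with h0 | hn
    · exact ⟨⟨fun _ _ => x₀, fun _ => none⟩, fun h => absurd h0 h.ne'⟩
    · obtain ⟨c, hc⟩ := exists_code_le hW hP hγ R hn
      exact ⟨c, fun _ => hc⟩
  choose c hc using hex
  have hlim : Tendsto (fun n : ℕ => (∑ a : X × Y, P a.1 * margY W a.1 a.2 *
        (infoDensity (margY W) P a.1 a.2 - inputInfo W P) ^ 2) / (inputInfo W P - γ) ^ 2
          * (1 / (n : ℝ)) + 2 ^ ((n : ℝ) * (R - γ)) + Fintype.card Z * (1 / (n : ℝ)))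
      atTop (𝓝 0) := by
    have h1 := tendsto_one_div_atTop_nhds_zero_nat (𝕜 := ℝ)
    have h2 : Tendsto (fun n : ℕ => (2 : ℝ) ^ ((n : ℝ) * (R - γ))) atTop (𝓝 0) := by
      have h3 : ∀ n : ℕ, ((2 : ℝ) ^ (R - γ)) ^ n = 2 ^ ((n : ℝ) * (R - γ)) := fun n => by
        rw [mul_comm, Real.rpow_mul_natCast (by norm_num)]
      refine Tendsto.congr h3 (tendsto_pow_atTop_nhds_zero_of_lt_one (by positivity) ?_)
      exact Real.rpow_lt_one_of_one_lt_of_neg (by norm_num) (by linarith)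
    simpa using ((h1.const_mul _).add h2).add (h1.const_mul (Fintype.card Z : ℝ))
  have hcost : ∀ n, 0 ≤ ∑ ω, (c n).law W ω * typeSqDist (outPMF (margZ W) P) ω.2.2 := fun n =>
    Finset.sum_nonneg fun ω _ => mul_nonneg ((c n).law_nonneg hW ω) (typeSqDist_nonneg _ _)
  refine ⟨c, ?_, fun ε hε => ?_⟩
  · refine tendsto_of_tendsto_of_tendsto_of_le_of_le' tendsto_const_nhds hlim
      (Eventually.of_forall fun n => (c n).prob_nonneg hW _) ?_
    filter_upwards [eventually_gt_atTop 0] with n hn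
    linarith [hc n hn, hcost n]
  · have hlim' := hlim.const_mul (Fintype.card Z / ε ^ 2 : ℝ)
    rw [mul_zero] at hlim'
    refine tendsto_of_tendsto_of_tendsto_of_le_of_le' tendsto_const_nhds hlim'
      (Eventually.of_forall fun n => (c n).prob_nonneg hW _) ?_
    filter_upwards [eventually_gt_atTop 0] with n hn
    refine ((c n).prob_tv_le hW _ hε).trans (mul_le_mul_of_nonneg_left ?_ (by positivity))
    linarith [hc n hn, (c n).prob_nonneg hW {ω | (c n).dec ω.2.1 ≠ some ω.1}]

end Achievability

/-! ### Converse. -/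

section Converse

variable {X Y Z : Type*}

open Classical in
/-- The average over the messages of the types of the codewords. -/
noncomputable def Code.avgType {n : ℕ} {R : ℝ} (c : Code X Y n R) (x : X) : ℝ :=
  ∑ m, (1 / (numMsg n R : ℝ)) * ((1 / (n : ℝ)) * ∑ i, if c.enc m i = x then 1 else 0)

theorem Code.sum_avgType_mul [Fintype X] {n : ℕ} {R : ℝ} (c : Code X Y n R) (φ : X → ℝ) :
    ∑ x, c.avgType x * φ x =
      ∑ m, (1 / (numMsg n R : ℝ)) * ((1 / (n : ℝ)) * ∑ i, φ (c.enc m i)) := by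
  classical
  simp only [Code.avgType, Finset.sum_mul, Finset.mul_sum]
  rw [Finset.sum_comm]
  refine Finset.sum_congr rfl fun m _ => ?_
  rw [Finset.sum_comm]
  refine Finset.sum_congr rfl fun i _ => ?_
  simp [mul_assoc]

theorem Code.avgType_mem_stdSimplex [Fintype X] {n : ℕ} (hn : 0 < n) {R : ℝ} (c : Code X Y n R) :
    c.avgType ∈ stdSimplex ℝ X := by
  have hn' : (n : ℝ) ≠ 0 := by exact_mod_cast hn.ne'
  have hM : (numMsg n R : ℝ) ≠ 0 := by exact_mod_cast (numMsg_pos n R).ne'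
  constructor
  · intro x
    unfold Code.avgType
    positivity
  · have h := c.sum_avgType_mul fun _ => 1
    simp only [mul_one] at h
    rw [h]
    simp [hn', hM]

/-- Gives the absolute continuity behind the divergence: the average output law is positive wherever
a used input letter can lead. -/
theorem Code.avgType_enc_ne_zero {n : ℕ} {R : ℝ} (c : Code X Y n R) (m : Fin (numMsg n R))
    (i : Fin n) : c.avgType (c.enc m i) ≠ 0 := by
  classical
  have hn : (0 : ℝ) < n := by exact_mod_cast i.pos
  have hM : (0 : ℝ) < numMsg n R := by exact_mod_cast numMsg_pos n R
  refine ne_of_gt (Finset.sum_pos' (fun m' _ => by positivity) ⟨m, Finset.mem_univ m, ?_⟩)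
  refine mul_pos (by positivity) (mul_pos (by positivity) ?_)
  exact Finset.sum_pos' (fun j _ => by positivity) ⟨i, Finset.mem_univ i, by simp⟩

theorem seqType_mem_Icc {n : ℕ} (s : Fin n → Z) (z : Z) : seqType s z ∈ Set.Icc (0 : ℝ) 1 := by
  classical
  constructor
  · unfold seqType
    positivity
  · simp only [seqType]
    rw [one_div, ← div_eq_inv_mul]
    refine div_le_one_of_le₀ ?_ (by positivity)
    refine (Finset.sum_le_card_nsmul _ _ 1 fun i _ => ?_).trans (by simp)
    split_ifs <;> norm_num

variable [Fintype X] [Fintype Y] [Fintype Z]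

/-- The divergence of the joint law of the message and the channel output from the product of
the uniform law and the memoryless law with the average output distribution of a code. -/
theorem Code.divergence_eq {W : X → Y × Z → ℝ} (hW : IsChannel W) {n : ℕ} (hn : 0 < n) {R : ℝ}
    (c : Code X Y n R) :
    ∑ a : Fin (numMsg n R) × (Fin n → Y),
        (1 / (numMsg n R : ℝ) * blockChannel (margY W) (c.enc a.1) a.2) *
          Real.logb 2 ((1 / (numMsg n R : ℝ) * blockChannel (margY W) (c.enc a.1) a.2) /
            (1 / (numMsg n R : ℝ) * ∏ i, outPMF (margY W) c.avgType (a.2 i))) =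
      n * inputInfo W c.avgType := by
  have hn' : (n : ℝ) ≠ 0 := by exact_mod_cast hn.ne'
  have hM : (1 / (numMsg n R : ℝ)) ≠ 0 := by
    have : (numMsg n R : ℝ) ≠ 0 := by exact_mod_cast (numMsg_pos n R).ne'
    positivity
  have hV := margY_mem_stdSimplex hW
  have hP := c.avgType_mem_stdSimplex hn
  rw [inputInfo_eq_sum_infoDensity hW, c.sum_avgType_mul, Fintype.sum_prod_type, Finset.mul_sum]
  refine Finset.sum_congr rfl fun m _ => ?_
  rw [mul_left_comm, ← mul_assoc (n : ℝ), mul_one_div_cancel hn', one_mul, Finset.mul_sum]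
  have h1 : ∀ y : Fin n → Y, 1 / (numMsg n R : ℝ) * blockChannel (margY W) (c.enc m) y *
        Real.logb 2 ((1 / (numMsg n R : ℝ) * blockChannel (margY W) (c.enc m) y) /
          (1 / (numMsg n R : ℝ) * ∏ i, outPMF (margY W) c.avgType (y i))) =
      ∑ i, 1 / (numMsg n R : ℝ) * (blockChannel (margY W) (c.enc m) y *
        infoDensity (margY W) c.avgType (c.enc m i) (y i)) := by
    intro y
    rw [← Finset.mul_sum, ← Finset.mul_sum, mul_assoc, mul_div_mul_left _ _ hM]
    by_cases hz : blockChannel (margY W) (c.enc m) y = 0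
    · simp [hz]
    have hi : ∀ i, margY W (c.enc m i) (y i) ≠ 0 := fun i =>
      Finset.prod_ne_zero_iff.1 hz i (Finset.mem_univ i)
    rw [logb_blockChannel_div hi fun i =>
      (outPMF_pos hV hP (c.avgType_enc_ne_zero m i) (hi i)).ne']
  simp_rw [h1]
  rw [Finset.sum_comm]
  refine Finset.sum_congr rfl fun i _ => ?_
  rw [← Finset.mul_sum]
  congr 1
  exact sum_prod_mul_apply (p := fun k => margY W (c.enc m k)) (fun k => (hV _).2)
    (infoDensity (margY W) c.avgType (c.enc m i)) i

theorem Code.success_mul_rate_le {W : X → Y × Z → ℝ} (hW : IsChannel W) {n : ℕ} (hn : 0 < n)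
    {R : ℝ} (c : Code X Y n R) :
    (1 - c.prob W {ω | c.dec ω.2.1 ≠ some ω.1}) * R ≤
      inputInfo W c.avgType + 1 / (n : ℝ) := by
  classical
  have hn' : (0 : ℝ) < n := by exact_mod_cast hn
  have hM : (0 : ℝ) < numMsg n R := by exact_mod_cast numMsg_pos n R
  have hM1 : (1 : ℝ) ≤ numMsg n R := by exact_mod_cast numMsg_pos n R
  have hV := margY_mem_stdSimplex hW
  have hP := c.avgType_mem_stdSimplex hn
  have hQ := outPMF_mem_stdSimplex hV hP
  let J : Fin (numMsg n R) × (Fin n → Y) → ℝ := fun a =>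
    1 / (numMsg n R : ℝ) * blockChannel (margY W) (c.enc a.1) a.2
  let K : Fin (numMsg n R) × (Fin n → Y) → ℝ := fun a =>
    1 / (numMsg n R : ℝ) * ∏ i, outPMF (margY W) c.avgType (a.2 i)
  let E : Fin (numMsg n R) × (Fin n → Y) → Prop := fun a => c.dec a.2 = some a.1
  have hQ1 : ∑ y : Fin n → Y, ∏ i, outPMF (margY W) c.avgType (y i) = 1 :=
    sum_prod_eq_one fun _ => hQ.2
  have hQ0 : ∀ y : Fin n → Y, 0 ≤ ∏ i, outPMF (margY W) c.avgType (y i) := fun y =>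
    Finset.prod_nonneg fun i _ => hQ.1 _
  have hJ : J ∈ stdSimplex ℝ (Fin (numMsg n R) × (Fin n → Y)) := by
    refine ⟨fun a => mul_nonneg (by positivity) ((blockChannel_mem_stdSimplex hV _).1 _), ?_⟩
    simp only [J, Fintype.sum_prod_type, ← Finset.mul_sum, (blockChannel_mem_stdSimplex hV _).2]
    simp [hM.ne']
  have hK0 : ∀ a, 0 ≤ K a := fun a => mul_nonneg (by positivity) (hQ0 _)
  have hK1 : ∑ a, K a ≤ 1 := by
    simp only [K, Fintype.sum_prod_type, ← Finset.mul_sum, hQ1]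
    simp [hM.ne']
  have hJK : ∀ a, J a ≠ 0 → K a ≠ 0 := by
    intro a ha
    refine mul_ne_zero (by positivity) (Finset.prod_ne_zero_iff.2 fun i _ => ?_)
    have hz := Finset.prod_ne_zero_iff.1 (right_ne_zero_of_mul ha) i (Finset.mem_univ i)
    exact (outPMF_pos hV hP (c.avgType_enc_ne_zero a.1 i) hz).ne'
  -- Under `K` the message is uniform and independent of `y`, so a guess is right with probability
  -- `1 / M`; a declared error adds zero.
  have hE : (numMsg n R : ℝ) * ∑ a, (if E a then K a else 0) ≤ 1 := by
    rw [Finset.mul_sum, Fintype.sum_prod_type_right, ← hQ1]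
    refine Finset.sum_le_sum fun y _ => ?_
    have h1 : ∀ m, (numMsg n R : ℝ) * (if E (m, y) then K (m, y) else 0) =
        if c.dec y = some m then ∏ i, outPMF (margY W) c.avgType (y i) else 0 := by
      intro m
      simp only [E, K]
      split_ifs
      · field_simp
      · simp
    simp_rw [h1]
    rcases c.dec y with _ | m₀
    · simpa using hQ0 y
    · simp
  have hmain := prob_mul_logb_le_divergence hJ hK0 hK1 hJK hM1 E hE
  rw [c.divergence_eq hW hn] at hmain
  have hsucc : (∑ a, if E a then J a else 0) =
      1 - c.prob W {ω | c.dec ω.2.1 ≠ some ω.1} := by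
    rw [eq_sub_iff_add_eq, ← hJ.2]
    have h1 := c.sum_law_mul_fst W fun m y => if c.dec y ≠ some m then 1 else 0
    have h2 : c.prob W {ω | c.dec ω.2.1 ≠ some ω.1} = ∑ a, if E a then 0 else J a := by
      rw [c.prob_setOf]
      refine Eq.trans h1 ?_
      rw [Fintype.sum_prod_type]
      refine Finset.sum_congr rfl fun m _ => ?_
      rw [Finset.mul_sum]
      refine Finset.sum_congr rfl fun y _ => ?_
      by_cases h : c.dec y = some m <;> simp [E, J, h]
    rw [h2, ← Finset.sum_add_distrib]
    refine Finset.sum_congr rfl fun a _ => ?_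
    split_ifs <;> simp
  rw [hsucc] at hmain
  have hs0 : 0 ≤ 1 - c.prob W {ω | c.dec ω.2.1 ≠ some ω.1} := by
    rw [← hsucc]
    refine Finset.sum_nonneg fun a _ => ?_
    split_ifs
    · exact hJ.1 a
    · exact le_rfl
  have hrate : (n : ℝ) * R ≤ Real.logb 2 (numMsg n R) := by
    rw [Real.le_logb_iff_rpow_le (by norm_num) hM]
    exact Nat.le_ceil _
  have h3 := (mul_le_mul_of_nonneg_left hrate hs0).trans hmain
  have h4 : inputInfo W c.avgType + 1 / (n : ℝ) = (n * inputInfo W c.avgType + 1) / n := by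
    field_simp
  rw [h4, le_div_iff₀ hn']
  linarith

/-- By linearity, only the average frequency of each input letter matters. -/
theorem Code.sum_law_mul_seqType {W : X → Y × Z → ℝ} (hW : IsChannel W) {n : ℕ} {R : ℝ}
    (c : Code X Y n R) (z : Z) :
    ∑ ω, c.law W ω * seqType ω.2.2 z = outPMF (margZ W) c.avgType z := by
  classical
  rw [c.sum_law_mul_snd W fun s => seqType s z, outPMF,
    c.sum_avgType_mul fun x => margZ W x z]
  refine Finset.sum_congr rfl fun m _ => ?_
  congr 1
  simp only [seqType]
  simp_rw [mul_left_comm _ (1 / (n : ℝ))]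
  rw [← Finset.mul_sum]
  congr 1
  simp_rw [Finset.mul_sum]
  rw [Finset.sum_comm]
  refine Finset.sum_congr rfl fun i _ => ?_
  refine (sum_prod_mul_apply (p := fun k => margZ W (c.enc m k))
    (fun k => (margZ_mem_stdSimplex hW _).2) (fun a => if a = z then 1 else 0) i).trans ?_
  simp

/-- Off the event one coordinate differs by at most twice the total variation; on it, by at most 1.
-/
theorem Code.abs_outPMF_sub_le {W : X → Y × Z → ℝ} (hW : IsChannel W) {n : ℕ} {R : ℝ}
    (c : Code X Y n R) {G : Z → ℝ} (hG : G ∈ stdSimplex ℝ Z) {ε : ℝ} (hε : 0 < ε) (z : Z) :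
    |outPMF (margZ W) c.avgType z - G z| ≤
      2 * ε + c.prob W {ω | ε ≤ tv (seqType ω.2.2) G} := by
  classical
  have h1 : outPMF (margZ W) c.avgType z - G z =
      ∑ ω, c.law W ω * (seqType ω.2.2 z - G z) := by
    simp_rw [mul_sub]
    rw [Finset.sum_sub_distrib, ← Finset.sum_mul, c.sum_law hW, c.sum_law_mul_seqType hW, one_mul]
  have h2 : 2 * ε + c.prob W {ω | ε ≤ tv (seqType ω.2.2) G} =
      ∑ ω, c.law W ω * (2 * ε + if ε ≤ tv (seqType ω.2.2) G then 1 else 0) := by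
    simp_rw [mul_add]
    rw [Finset.sum_add_distrib, ← Finset.sum_mul, c.sum_law hW, one_mul, c.prob_setOf]
  rw [h1, h2]
  refine (Finset.abs_sum_le_sum_abs _ _).trans (Finset.sum_le_sum fun ω _ => ?_)
  rw [abs_mul, abs_of_nonneg (c.law_nonneg hW ω)]
  refine mul_le_mul_of_nonneg_left ?_ (c.law_nonneg hW ω)
  split_ifs with h
  · have hs := seqType_mem_Icc ω.2.2 z
    have hz0 := hG.1 z
    have hz1 : G z ≤ 1 := by
      rw [← hG.2]
      exact Finset.single_le_sum (fun z _ => hG.1 z) (Finset.mem_univ z)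
    rw [abs_le]
    constructor <;> linarith [hs.1, hs.2]
  · have h3 : |seqType ω.2.2 z - G z| ≤ ∑ z, |seqType ω.2.2 z - G z| :=
      Finset.single_le_sum (f := fun z => |seqType ω.2.2 z - G z|) (fun _ _ => abs_nonneg _)
        (Finset.mem_univ z)
    have h4 : tv (seqType ω.2.2) G < ε := not_le.1 h
    rw [tv] at h4
    linarith

theorem exists_preimage_of_achievable {W : X → Y × Z → ℝ} (hW : IsChannel W) {R : ℝ}
    {G : Z → ℝ} (hG : G ∈ stdSimplex ℝ Z) (h : Achievable W R G) :
    ∃ P ∈ preimage W G, R ≤ inputInfo W P := by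
  obtain ⟨c, herr, htv⟩ := h
  -- The shift avoids `n = 0`, where the average type is zero and not a pmf.
  have hmem : ∀ n : ℕ, (c (n + 1)).avgType ∈ stdSimplex ℝ X := fun n =>
    (c (n + 1)).avgType_mem_stdSimplex n.succ_pos
  obtain ⟨P, hP, φ, hφ, hlim⟩ := (isCompact_stdSimplex ℝ X).tendsto_subseq hmem
  have hψ : Tendsto (fun k => φ k + 1) atTop atTop :=
    (tendsto_add_atTop_nat 1).comp hφ.tendsto_atTop
  have hout : ∀ z, Tendsto (fun k => outPMF (margZ W) (c (φ k + 1)).avgType z) atTop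
      (𝓝 (G z)) := by
    intro z
    rw [Metric.tendsto_atTop]
    intro δ hδ
    -- With `ε = δ / 4` the deviation bound is `2 ε` plus less than `δ / 4`, below `δ`.
    have h1 := ((htv (δ / 4) (by positivity)).comp hψ).eventually_lt_const
      (show (0 : ℝ) < δ / 4 by positivity)
    obtain ⟨N, hN⟩ := eventually_atTop.1 h1
    refine ⟨N, fun k hk => ?_⟩
    rw [Real.dist_eq]
    have h2 := hN k hk
    simp only [Function.comp_apply] at h2
    linarith [(c (φ k + 1)).abs_outPMF_sub_le hW hG (ε := δ / 4) (by positivity) z]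
  refine ⟨P, mem_preimage_iff.2 ⟨hP, funext fun z => ?_⟩, ?_⟩
  · exact tendsto_nhds_unique (((continuous_outPMF (margZ W) z).tendsto P).comp hlim) (hout z)
  · have h1 : Tendsto (fun k => inputInfo W (c (φ k + 1)).avgType) atTop
        (𝓝 (inputInfo W P)) :=
      (continuousOn_inputInfo hW P hP).tendsto.comp
        (tendsto_nhdsWithin_iff.2 ⟨hlim, Eventually.of_forall fun k => hmem (φ k)⟩)
    have h2 : Tendsto (fun k => 1 / ((φ k + 1 : ℕ) : ℝ)) atTop (𝓝 0) :=
      (tendsto_one_div_atTop_nhds_zero_nat (𝕜 := ℝ)).comp hψ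
    have h3 := ((herr.comp hψ).const_sub 1).mul_const R
    have h4 := h1.add h2
    rw [sub_zero, one_mul] at h3
    rw [add_zero] at h4
    exact le_of_tendsto_of_tendsto' h3 h4 fun k =>
      (c (φ k + 1)).success_mul_rate_le hW (φ k).succ_pos

end Converse

end CommInterf

theorem theorem1 {X Y Z : Type*} [Fintype X] [Fintype Y] [Fintype Z]
    (W : X → Y × Z → ℝ) (hW : CommInterf.IsChannel W) :
    CommInterf.capacityRegion W =
      {p : ℝ × (Z → ℝ) | p.2 ∈ stdSimplex ℝ Z ∧
        ∃ C : ℝ, IsGreatest (CommInterf.inputInfo W '' CommInterf.preimage W p.2) C ∧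
          p.1 ≤ C} := by
  open CommInterf in
  simp_rw [exists_isGreatest_iff hW]
  refine Set.Subset.antisymm (closure_minimal ?_ ?_) ?_
  · rintro p ⟨hG, hp⟩
    exact ⟨hG, exists_preimage_of_achievable hW hG hp⟩
  · exact ((isClosed_stdSimplex ℝ Z).preimage continuous_snd).inter (isClosed_region hW)
  · rintro ⟨R, G⟩ ⟨hG, P, hP, hR⟩
    obtain ⟨hPX, rfl⟩ := mem_preimage_iff.1 hP
    -- Lowering the rate by `1 / (n + 1)` makes it strictly less than the information, with the same
    -- `G`.
    refine mem_closure_of_tendsto (f := fun n : ℕ => (R - 1 / ((n : ℝ) + 1), outPMF (margZ W) P))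
      (b := atTop) ?_ (Eventually.of_forall fun n => ⟨hG, achievable_of_lt_inputInfo hW hPX ?_⟩)
    · refine Tendsto.prodMk_nhds ?_ tendsto_const_nhds
      simpa using (tendsto_one_div_add_atTop_nhds_zero_nat (𝕜 := ℝ)).const_sub R
    · have : 0 < 1 / ((n : ℝ) + 1) := by positivity
      simp only at hR
      linarith
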